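/- Let $G$ be a finite-dimensional Lie group with Lie algebra $\mathfrak g$, and let $M=G/H$ be a homogeneous space of $G$, that is, a smooth manifold on which $G$ acts smoothly and transitively, with orbit maps $g\mapsto g\cdot q$ that are submersions; fix an origin $p\in M$. For $W\in\mathfrak g$ let $W^*_q=\frac{d}{dt}\big|_{t=0}\exp(tW)\cdot q$ be its fundamental vector field. Let $\tilde a$ be a smooth Riemannian metric on $M$ and $X$ a smooth vector field on $M$ with $\tilde a_x(X_x,X_x)<1$ for all $x\in M$, and let $$F(x,y)=\sqrt{\tilde a_x(y,y)}+\tilde a_x(X_x,y),\qquad x\in M,\ y\in T_xM,$$ be the associated Randers metric. Assume that $(M,F)$ is homogeneous under $G$, i.e. $F$ is $G$-invariant. For a Finsler function $\Phi$ on $M$, a constant speed geodesic of $(M,\Phi)$ is a smooth curve $\sigma$ such that $\Phi(\sigma,\dot\sigma)$ is a positive constant and $\sigma$ satisfies, in local coordinates, the Euler–Lagrange equations $\frac{d}{dt}\frac{\partial \Phi}{\partial y^i}(\sigma,\dot\sigma)=\frac{\partial \Phi}{\partial x^i}(\sigma,\dot\sigma)$ of the length functional $\int \Phi(\sigma,\dot\sigma)\,dt$.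 A nonzero $W\in\mathfrak g$ is a geodesic vector of $(M,\Phi)$ if $t\mapsto\exp(tW)\cdot p$ is a constant speed geodesic of $(M,\Phi)$; the geodesic vectors of $(M,\tilde a)$ are those for $\Phi(x,y)=\sqrt{\tilde a_x(y,y)}$. Let $W\in\mathfrak g$ represent $X$ at the origin, i.e. $W^*_p=X_p$ (for instance, given a reductive decomposition $\mathfrak g=\mathfrak m\oplus\mathfrak h$, the element of $\mathfrak m$ corresponding to $X_p$ under $\mathfrak m\cong T_pM$). Then $W$ is a geodesic vector of $(M,\tilde a)$ if and only if $W$ is a geodesic vector of $(M,F)$. -/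

import Mathlib

open scoped Manifold ContDiff

noncomputable section HomogeneousRanders

/-- The left action of a Lie group `G` on a manifold `M` exhibits `M` as a homogeneous space `G / H`
(with `H` the isotropy group of any point): the action is smooth and transitive, and every orbit map
`g ↦ g • q`, which corresponds to the projection `G → G / H`, is a submersion. -/
structure IsHomogeneousSpace
    (EG : Type*) [NormedAddCommGroup EG] [NormedSpace ℝ EG]
    (G : Type*) [Group G] [TopologicalSpace G] [ChartedSpace EG G]
    (E : Type*) [NormedAddCommGroup E] [NormedSpace ℝ E]
    (M : Type*) [TopologicalSpace M] [ChartedSpace E M] [MulAction G M] : Prop where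
  smooth_action : ContMDiffSMul 𝓘(ℝ, EG) 𝓘(ℝ, E) ∞ G M
  transitive : MulAction.IsPretransitive G M
  orbit_submersion : ∀ q : M,
    Function.Surjective (mfderiv 𝓘(ℝ, EG) 𝓘(ℝ, E) (fun g : G => g • q) (1 : G))

/-- The value at `q` of the fundamental vector field `W*` of `W` in the Lie algebra of `G`: the
derivative of the orbit map `g ↦ g • q` at the identity, applied to `W`. -/
def fundamentalVector
    {EG : Type*} [NormedAddCommGroup EG] [NormedSpace ℝ EG]
    {G : Type*} [Group G] [TopologicalSpace G] [ChartedSpace EG G]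
    {E : Type*} [NormedAddCommGroup E] [NormedSpace ℝ E]
    {M : Type*} [TopologicalSpace M] [ChartedSpace E M] [MulAction G M]
    (W : GroupLieAlgebra 𝓘(ℝ, EG) G) (q : M) : TangentSpace 𝓘(ℝ, E) q :=
  mfderiv 𝓘(ℝ, EG) 𝓘(ℝ, E) (fun g : G => g • q) (1 : G) W

/-- `φ` is the one-parameter subgroup `t ↦ exp (t W)` of `G`: the (unique) smooth homomorphism
`ℝ → G` whose velocity at `0` is `W`. -/
structure IsOneParameterSubgroup
    {EG : Type*} [NormedAddCommGroup EG] [NormedSpace ℝ EG]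
    {G : Type*} [Group G] [TopologicalSpace G] [ChartedSpace EG G]
    (φ : ℝ → G) (W : GroupLieAlgebra 𝓘(ℝ, EG) G) : Prop where
  smooth : ContMDiff 𝓘(ℝ, ℝ) 𝓘(ℝ, EG) ∞ φ
  map_zero : φ 0 = 1
  map_add : ∀ s t : ℝ, φ (s + t) = φ s * φ t
  velocity_zero : mfderiv 𝓘(ℝ, ℝ) 𝓘(ℝ, EG) φ 0 (1 : ℝ) = W

/-- A function `F` on the tangent bundle is invariant under `G`, i.e. `G` acts by isometries of
`(M, F)`. -/
def IsInvariantFinsler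
    (G : Type*) [Group G]
    {E : Type*} [NormedAddCommGroup E] [NormedSpace ℝ E]
    {M : Type*} [TopologicalSpace M] [ChartedSpace E M] [MulAction G M]
    (F : (x : M) → TangentSpace 𝓘(ℝ, E) x → ℝ) : Prop :=
  ∀ (g : G) (x : M) (v : TangentSpace 𝓘(ℝ, E) x),
    F (g • x) (mfderiv 𝓘(ℝ, E) 𝓘(ℝ, E) (fun y : M => g • y) x v) = F x v

/-- The velocity of a curve in `M`. -/
def velocity
    {E : Type*} [NormedAddCommGroup E] [NormedSpace ℝ E]
    {M : Type*} [TopologicalSpace M] [ChartedSpace E M]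
    (σ : ℝ → M) (t : ℝ) : TangentSpace 𝓘(ℝ, E) (σ t) :=
  mfderiv 𝓘(ℝ, ℝ) 𝓘(ℝ, E) σ t (1 : ℝ)

/-- The local expression `F(x, y)` of a Finsler function in the coordinates given by a chart `e`:
`x` is the coordinate vector of the point, `y` that of the tangent vector. -/
def finslerInChart
    {E : Type*} [NormedAddCommGroup E] [NormedSpace ℝ E]
    {M : Type*} [TopologicalSpace M] [ChartedSpace E M]
    (F : (x : M) → TangentSpace 𝓘(ℝ, E) x → ℝ) (e : OpenPartialHomeomorph M E) (x y : E) : ℝ :=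
  F (e.symm x) (mfderiv 𝓘(ℝ, E) 𝓘(ℝ, E) e.symm x y)

/-- The Euler-Lagrange equation `d/dt (∂L/∂y) = ∂L/∂x` at time `t` for the curve `c` in the
coordinate space `E`, as an equation between linear functionals on `E`; the derivative on the left
is required to exist. -/
def EulerLagrangeAt
    {E : Type*} [NormedAddCommGroup E] [NormedSpace ℝ E]
    (L : E → E → ℝ) (c : ℝ → E) (t : ℝ) : Prop :=
  HasDerivAt (fun s => fderiv ℝ (fun y => L (c s) y) (deriv c s))
    (fderiv ℝ (fun x => L x (deriv c t)) (c t)) t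

/-- `σ` is a constant speed geodesic of `(M, F)`: a smooth regular curve on which `F(σ, σ')` is
constant and which is an extremal of the length functional `∫ F(σ, σ') dt`, i.e. in every chart its
local expression satisfies the Euler-Lagrange equations of `F`. -/
structure IsConstantSpeedGeodesic
    {E : Type*} [NormedAddCommGroup E] [NormedSpace ℝ E]
    {M : Type*} [TopologicalSpace M] [ChartedSpace E M]
    (F : (x : M) → TangentSpace 𝓘(ℝ, E) x → ℝ) (σ : ℝ → M) : Prop where
  smooth : ContMDiff 𝓘(ℝ, ℝ) 𝓘(ℝ, E) ∞ σ
  constant_speed : ∃ c : ℝ, 0 < c ∧ ∀ t, F (σ t) (velocity σ t) = c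
  euler_lagrange : ∀ e ∈ atlas E M, ∀ t : ℝ, σ t ∈ e.source →
    EulerLagrangeAt (finslerInChart F e) (fun s => e (σ s)) t

/-- A nonzero `W` in the Lie algebra of `G` is a geodesic vector of `(M, F)` (with origin `p`) if
the orbit `t ↦ exp (t W) • p` is a constant speed geodesic of `(M, F)`. -/
def IsGeodesicVector
    {EG : Type*} [NormedAddCommGroup EG] [NormedSpace ℝ EG]
    {G : Type*} [Group G] [TopologicalSpace G] [ChartedSpace EG G]
    {E : Type*} [NormedAddCommGroup E] [NormedSpace ℝ E]
    {M : Type*} [TopologicalSpace M] [ChartedSpace E M] [MulAction G M]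
    (F : (x : M) → TangentSpace 𝓘(ℝ, E) x → ℝ) (p : M)
    (W : GroupLieAlgebra 𝓘(ℝ, EG) G) : Prop :=
  W ≠ 0 ∧ ∃ φ : ℝ → G, IsOneParameterSubgroup φ W ∧
    IsConstantSpeedGeodesic F (fun t => φ t • p)

/-- The norm function `α(x, y) = √(a_x(y, y))` of a Riemannian metric `a`, i.e. the metric seen as
a Finsler metric. -/
def riemannianFinsler
    {E : Type*} [NormedAddCommGroup E] [NormedSpace ℝ E]
    {M : Type*} [TopologicalSpace M] [ChartedSpace E M] [IsManifold 𝓘(ℝ, E) ∞ M]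
    (a : Bundle.ContMDiffRiemannianMetric 𝓘(ℝ, E) ∞ E
      (fun x : M => TangentSpace 𝓘(ℝ, E) x))
    (x : M) (y : TangentSpace 𝓘(ℝ, E) x) : ℝ :=
  √(a.inner x y y)

/-- The Randers function `F(x, y) = √(a_x(y, y)) + a_x(X_x, y)` of a Riemannian metric `a` and a
vector field `X`. -/
def randersFinsler
    {E : Type*} [NormedAddCommGroup E] [NormedSpace ℝ E]
    {M : Type*} [TopologicalSpace M] [ChartedSpace E M] [IsManifold 𝓘(ℝ, E) ∞ M]
    (a : Bundle.ContMDiffRiemannianMetric 𝓘(ℝ, E) ∞ E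
      (fun x : M => TangentSpace 𝓘(ℝ, E) x))
    (X : (x : M) → TangentSpace 𝓘(ℝ, E) x)
    (x : M) (y : TangentSpace 𝓘(ℝ, E) x) : ℝ :=
  √(a.inner x y y) + a.inner x (X x) y

end HomogeneousRanders

open scoped Manifold ContDiff Topology

/-! ### Invariance of the metric, the one-form and the vector field -/

section Isometries

variable {G : Type*} [Group G]
  {E : Type*} [NormedAddCommGroup E] [NormedSpace ℝ E]
  {M : Type*} [TopologicalSpace M] [ChartedSpace E M] [IsManifold 𝓘(ℝ, E) ∞ M] [MulAction G M]
  {a : Bundle.ContMDiffRiemannianMetric 𝓘(ℝ, E) ∞ E (fun x : M => TangentSpace 𝓘(ℝ, E) x)}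
  {X : (x : M) → TangentSpace 𝓘(ℝ, E) x}

/-! Write `F = α + β` with `α = √ã` and `β = ã(X, ·)`. Translations preserve `F`, hence `α`, `β` and
therefore `X`; by transitivity `ã(X, X)` is a constant `k`. The orbit of `p` under `exp (t W)` is
thus an integral curve of `X`.

Along it, the partial derivatives of `F` are those of `α` times `1 + √k`. In the fibre, `dα` at `X`
is `β / √k`. In the base, let `V` be the coordinate-constant field equal to `X` at the point: `ã(X -
V, X - V) = k - 2 ã(X, V) + ã(V, V)` is nonnegative and vanishes there, so `d(ã(X, V)) = d(ã(V, V))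
/ 2 = √k d(α(V))`. Both sides of the Euler–Lagrange equation therefore scale by the same nonzero
constant. -/

theorem riemannianMetric_self_nonneg (x : M) (v : TangentSpace 𝓘(ℝ, E) x) :
    0 ≤ a.inner x v v := by
  rcases eq_or_ne v 0 with rfl | hv
  · simp
  · exact (a.pos x v hv).le

theorem riemannianMetric_add_self (x : M) (u v : TangentSpace 𝓘(ℝ, E) x) :
    a.inner x (u + v) (u + v) = a.inner x u u + 2 * a.inner x u v + a.inner x v v := by
  simp only [map_add, add_apply]
  rw [a.symm x v u]
  ring

theorem riemannianMetric_sub_self (x : M) (u v : TangentSpace 𝓘(ℝ, E) x) :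
    a.inner x (u - v) (u - v) = a.inner x u u - 2 * a.inner x u v + a.inner x v v := by
  simp only [map_sub, sub_apply]
  rw [a.symm x v u]
  ring

/-- The Riemannian norm and the one-form of an invariant Randers metric are both invariant: they are
its even and odd parts. -/
theorem IsInvariantFinsler.norm_and_form (hF : IsInvariantFinsler G (randersFinsler a X))
    (g : G) (x : M) (v : TangentSpace 𝓘(ℝ, E) x) :
    a.inner (g • x) (mfderiv 𝓘(ℝ, E) 𝓘(ℝ, E) (fun y : M => g • y) x v)
        (mfderiv 𝓘(ℝ, E) 𝓘(ℝ, E) (fun y : M => g • y) x v) = a.inner x v v ∧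
      a.inner (g • x) (X (g • x)) (mfderiv 𝓘(ℝ, E) 𝓘(ℝ, E) (fun y : M => g • y) x v) =
        a.inner x (X x) v := by
  have h1 := hF g x v
  have h2 := hF g x (-v)
  simp only [randersFinsler, map_neg, neg_apply, neg_neg] at h1 h2
  refine ⟨?_, by linarith⟩
  rw [← Real.sqrt_inj (riemannianMetric_self_nonneg _ _) (riemannianMetric_self_nonneg _ _)]
  linarith

/-- The vector field of an invariant Randers metric is invariant. -/
theorem IsInvariantFinsler.mfderiv_smul_apply [FiniteDimensional ℝ E]
    (hF : IsInvariantFinsler G (randersFinsler a X)) (g : G) (x : M) :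
    mfderiv 𝓘(ℝ, E) 𝓘(ℝ, E) (fun y : M => g • y) x (X x) = X (g • x) := by
  let D : TangentSpace 𝓘(ℝ, E) x →L[ℝ] TangentSpace 𝓘(ℝ, E) (g • x) :=
    mfderiv 𝓘(ℝ, E) 𝓘(ℝ, E) (fun y : M => g • y) x
  have hnorm : ∀ v, a.inner (g • x) (D v) (D v) = a.inner x v v :=
    fun v => (hF.norm_and_form g x v).1
  have hform : ∀ v, a.inner (g • x) (X (g • x)) (D v) = a.inner x (X x) v :=
    fun v => (hF.norm_and_form g x v).2
  have hinner : ∀ u v, a.inner (g • x) (D u) (D v) = a.inner x u v := by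
    intro u v
    have h := hnorm (u + v)
    rw [map_add, riemannianMetric_add_self, riemannianMetric_add_self, hnorm, hnorm] at h
    linarith
  let L : E →ₗ[ℝ] E := D.toLinearMap
  have hinj : Function.Injective L := by
    rw [injective_iff_map_eq_zero]
    intro v hv
    by_contra hne
    have h := a.pos x v hne
    rw [← hnorm v] at h
    have hv' : D v = 0 := hv
    simp [hv'] at h
  -- `D X - X` is orthogonal to the image of `D`, which is everything since the dimensions agree; so
  -- it is orthogonal to itself.
  obtain ⟨w, hw⟩ : ∃ w : TangentSpace 𝓘(ℝ, E) x, D w = D (X x) - X (g • x) :=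
    (LinearMap.injective_iff_surjective.1 hinj) (D (X x) - X (g • x))
  by_contra hne
  have h := a.pos (g • x) (D (X x) - X (g • x)) (sub_ne_zero.2 hne)
  have h0 : a.inner (g • x) (D (X x) - X (g • x)) (D w) = 0 := by
    rw [map_sub, sub_apply, hinner, hform, sub_self]
  rw [hw] at h0
  exact h.ne' h0

/-- On a homogeneous space the vector field of an invariant Randers metric has constant length. -/
theorem IsInvariantFinsler.inner_self_eq [FiniteDimensional ℝ E] [MulAction.IsPretransitive G M]
    (hF : IsInvariantFinsler G (randersFinsler a X)) (p x : M) :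
    a.inner x (X x) (X x) = a.inner p (X p) (X p) := by
  obtain ⟨g, rfl⟩ := MulAction.exists_smul_eq G p x
  have h := (hF.norm_and_form g p (X p)).1
  rwa [hF.mfderiv_smul_apply g p] at h

end Isometries

/-! ### Orbits of one-parameter subgroups -/

section Orbits

variable {EG : Type*} [NormedAddCommGroup EG] [NormedSpace ℝ EG]
  {G : Type*} [Group G] [TopologicalSpace G] [ChartedSpace EG G]
  {E : Type*} [NormedAddCommGroup E] [NormedSpace ℝ E]
  {M : Type*} [TopologicalSpace M] [ChartedSpace E M] [MulAction G M]

theorem contMDiff_orbitMap [ContMDiffSMul 𝓘(ℝ, EG) 𝓘(ℝ, E) ∞ G M] (q : M) :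
    ContMDiff 𝓘(ℝ, EG) 𝓘(ℝ, E) ∞ (fun g : G => g • q) :=
  (contMDiff_smul (I := 𝓘(ℝ, EG)) (I' := 𝓘(ℝ, E))).comp
    (contMDiff_id.prodMk contMDiff_const)

theorem contMDiff_translation [ContMDiffSMul 𝓘(ℝ, EG) 𝓘(ℝ, E) ∞ G M] (g : G) :
    ContMDiff 𝓘(ℝ, E) 𝓘(ℝ, E) ∞ (fun y : M => g • y) :=
  (contMDiff_smul (I := 𝓘(ℝ, EG)) (I' := 𝓘(ℝ, E))).comp
    (contMDiff_const.prodMk contMDiff_id)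

namespace IsOneParameterSubgroup

variable {φ : ℝ → G} {W : GroupLieAlgebra 𝓘(ℝ, EG) G}

theorem contMDiff_orbit [ContMDiffSMul 𝓘(ℝ, EG) 𝓘(ℝ, E) ∞ G M]
    (hφ : IsOneParameterSubgroup φ W) (p : M) :
    ContMDiff 𝓘(ℝ, ℝ) 𝓘(ℝ, E) ∞ (fun t => φ t • p) :=
  (contMDiff_orbitMap (EG := EG) p).comp hφ.smooth

/-- The velocity at time `0` of an orbit is the value of the fundamental vector field. -/
theorem velocity_orbit_zero [ContMDiffSMul 𝓘(ℝ, EG) 𝓘(ℝ, E) ∞ G M]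
    (hφ : IsOneParameterSubgroup φ W) (p : M) :
    (velocity (fun t => φ t • p) 0 : E) = (fundamentalVector W p : E) := by
  have h1 : MDifferentiableAt 𝓘(ℝ, EG) 𝓘(ℝ, E) (fun g : G => g • p) (φ 0) :=
    (contMDiff_orbitMap (EG := EG) p).mdifferentiable (by simp) _
  have h2 : MDifferentiableAt 𝓘(ℝ, ℝ) 𝓘(ℝ, EG) φ 0 := hφ.smooth.mdifferentiable (by simp) _
  have h := mfderiv_comp_apply (0 : ℝ) h1 h2 (1 : ℝ)
  have h3 : mfderiv 𝓘(ℝ, ℝ) 𝓘(ℝ, EG) φ 0 (1 : ℝ) = (W : EG) := hφ.velocity_zero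
  have h4 : ((mfderiv 𝓘(ℝ, EG) 𝓘(ℝ, E) (fun g : G => g • p) (φ 0) : EG →L[ℝ] E)) =
      (mfderiv 𝓘(ℝ, EG) 𝓘(ℝ, E) (fun g : G => g • p) 1 : EG →L[ℝ] E) := by
    rw [hφ.map_zero]
  exact h.trans ((congrArg _ h3).trans (congrArg (fun D : EG →L[ℝ] E => D W) h4))

/-- The velocity of an orbit is obtained from the initial velocity by translation. -/
theorem velocity_orbit [ContMDiffSMul 𝓘(ℝ, EG) 𝓘(ℝ, E) ∞ G M]
    (hφ : IsOneParameterSubgroup φ W) (p : M) (t : ℝ) :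
    velocity (fun t => φ t • p) t =
      mfderiv 𝓘(ℝ, E) 𝓘(ℝ, E) (fun y : M => φ t • y) p (fundamentalVector W p) := by
  -- Shifting time by `-t` moves the differentiation at `t` back to time `0`.
  have hshift : (fun s : ℝ => φ s • p) =
      (fun y : M => φ t • y) ∘ (fun s : ℝ => φ s • p) ∘ (fun s : ℝ => -t + s) := by
    funext s
    simp only [Function.comp_apply]
    rw [smul_smul, ← hφ.map_add, add_neg_cancel_left]
  have hσ := (hφ.contMDiff_orbit (E := E) p).mdifferentiable (by simp)
  have hτ : HasMFDerivAt 𝓘(ℝ, ℝ) 𝓘(ℝ, ℝ) (fun s : ℝ => -t + s) t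
      (ContinuousLinearMap.id ℝ ℝ) := ((hasFDerivAt_id t).const_add (-t)).hasMFDerivAt
  have hr : -t + t = 0 := neg_add_cancel t
  have hp : φ (-t + t) • p = p := by rw [hr, hφ.map_zero, one_smul]
  have hg : MDifferentiableAt 𝓘(ℝ, E) 𝓘(ℝ, E) (fun y : M => φ t • y) (φ (-t + t) • p) :=
    (contMDiff_translation (EG := EG) (φ t)).mdifferentiable (by simp) _
  have hcomp := hg.hasMFDerivAt.comp t ((hσ (-t + t)).hasMFDerivAt.comp t hτ)
  rw [← hshift] at hcomp
  -- Ascribing the derivatives to maps of the model spaces removes the dependence of their types on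
  -- the base point, so the base points can be rewritten.
  have h1 : ((mfderiv 𝓘(ℝ, E) 𝓘(ℝ, E) (fun y : M => φ t • y) (φ (-t + t) • p)) : E →L[ℝ] E) =
      (mfderiv 𝓘(ℝ, E) 𝓘(ℝ, E) (fun y : M => φ t • y) p : E →L[ℝ] E) := by rw [hp]
  have h2 : ((mfderiv 𝓘(ℝ, ℝ) 𝓘(ℝ, E) (fun s : ℝ => φ s • p) (-t + t)) : ℝ →L[ℝ] E) =
      (mfderiv 𝓘(ℝ, ℝ) 𝓘(ℝ, E) (fun s : ℝ => φ s • p) 0 : ℝ →L[ℝ] E) := by rw [hr]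
  have h3 := congrArg (fun D : ℝ →L[ℝ] E => D 1) hcomp.mfderiv
  let D : E →L[ℝ] E := mfderiv 𝓘(ℝ, E) 𝓘(ℝ, E) (fun y : M => φ t • y) p
  exact h3.trans ((congrArg (fun L : E →L[ℝ] E => L _) h1).trans
    ((congrArg (fun L : ℝ →L[ℝ] E => D (L 1)) h2).trans
      (congrArg D (hφ.velocity_orbit_zero p))))

end IsOneParameterSubgroup

end Orbits

/-! ### Euler–Lagrange equations in charts -/

section Coordinates

variable {E : Type*} [NormedAddCommGroup E] [NormedSpace ℝ E]
  {M : Type*} [TopologicalSpace M] [ChartedSpace E M]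

/-- The derivative of a chart inverse sends the derivative of the coordinate expression of a smooth
curve to the velocity of the curve. -/
theorem mfderiv_symm_deriv_chart [IsManifold 𝓘(ℝ, E) ∞ M] {e : OpenPartialHomeomorph M E}
    (he : e ∈ atlas E M) {σ : ℝ → M} (hσ : ContMDiff 𝓘(ℝ, ℝ) 𝓘(ℝ, E) ∞ σ) {t : ℝ}
    (ht : σ t ∈ e.source) :
    (mfderiv 𝓘(ℝ, E) 𝓘(ℝ, E) e.symm (e (σ t)) (deriv (fun s => e (σ s)) t) : E) =
      (velocity σ t : E) := by
  have hmax := IsManifold.subset_maximalAtlas (I := 𝓘(ℝ, E)) (n := ∞) he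
  have h1 : MDifferentiableAt 𝓘(ℝ, E) 𝓘(ℝ, E) e.symm (e (σ t)) :=
    (contMDiffAt_symm_of_mem_maximalAtlas hmax (e.map_source ht)).mdifferentiableAt (by simp)
  have h2 : MDifferentiableAt 𝓘(ℝ, ℝ) 𝓘(ℝ, E) (fun s => e (σ s)) t :=
    ((contMDiffAt_of_mem_maximalAtlas hmax ht).comp t (hσ t)).mdifferentiableAt (by simp)
  have h := mfderiv_comp_apply t h1 h2 (1 : ℝ)
  have heq : (e.symm ∘ fun s => e (σ s)) =ᶠ[𝓝 t] σ := by
    filter_upwards [hσ.continuous.continuousAt.preimage_mem_nhds (e.open_source.mem_nhds ht)]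
      with s hs using e.left_inv hs
  have h3 : (mfderiv 𝓘(ℝ, ℝ) 𝓘(ℝ, E) (e.symm ∘ fun s => e (σ s)) t : ℝ →L[ℝ] E) =
      (mfderiv 𝓘(ℝ, ℝ) 𝓘(ℝ, E) σ t : ℝ →L[ℝ] E) := heq.mfderiv_eq
  have h4 : mfderiv 𝓘(ℝ, ℝ) 𝓘(ℝ, E) (fun s => e (σ s)) t (1 : ℝ) =
      deriv (fun s => e (σ s)) t := by
    rw [mfderiv_eq_fderiv, ← fderiv_apply_one_eq_deriv]; rfl
  let D : E →L[ℝ] E := mfderiv 𝓘(ℝ, E) 𝓘(ℝ, E) e.symm (e (σ t))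
  exact (congrArg D h4).symm.trans
    (h.symm.trans (congrArg (fun L : ℝ →L[ℝ] E => L 1) h3))

variable [IsManifold 𝓘(ℝ, E) ∞ M]
  {a : Bundle.ContMDiffRiemannianMetric 𝓘(ℝ, E) ∞ E (fun x : M => TangentSpace 𝓘(ℝ, E) x)}
  {X : (x : M) → TangentSpace 𝓘(ℝ, E) x} {e : OpenPartialHomeomorph M E}

/-- The pairing of two smooth vector fields along a smooth map is differentiable. -/
theorem differentiableAt_inner_along {f : E → M} {x₀ : E}
    {u v : (x : E) → TangentSpace 𝓘(ℝ, E) (f x)}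
    (hf : ContMDiffAt 𝓘(ℝ, E) 𝓘(ℝ, E) ∞ f x₀)
    (hu : ContMDiffAt 𝓘(ℝ, E) (𝓘(ℝ, E).prod 𝓘(ℝ, E)) ∞
      (fun x => (⟨f x, u x⟩ : TangentBundle 𝓘(ℝ, E) M)) x₀)
    (hv : ContMDiffAt 𝓘(ℝ, E) (𝓘(ℝ, E).prod 𝓘(ℝ, E)) ∞
      (fun x => (⟨f x, v x⟩ : TangentBundle 𝓘(ℝ, E) M)) x₀) :
    DifferentiableAt ℝ (fun x => a.inner (f x) (u x) (v x)) x₀ := by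
  have h := ContMDiffAt.clm_bundle_apply₂ (F₁ := E) (F₂ := E) (F₃ := ℝ)
    (E₁ := fun x : M => TangentSpace 𝓘(ℝ, E) x) (E₂ := fun x : M => TangentSpace 𝓘(ℝ, E) x)
    (E₃ := Bundle.Trivial M ℝ) (ψ := fun x => a.inner (f x))
    ((a.contMDiff (f x₀)).comp x₀ hf) hu hv
  rw [Bundle.contMDiffAt_totalSpace] at h
  exact (contMDiffAt_iff_contDiffAt.1 h.2).differentiableAt (by simp)

/-- The coordinate vector fields are smooth. -/
theorem contMDiffAt_mfderiv_symm_const (he : e ∈ atlas E M) {x₀ : E} (hx₀ : x₀ ∈ e.target) (v : E) :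
    ContMDiffAt 𝓘(ℝ, E) (𝓘(ℝ, E).prod 𝓘(ℝ, E)) ∞
      (fun x => (⟨e.symm x, mfderiv 𝓘(ℝ, E) 𝓘(ℝ, E) e.symm x v⟩ : TangentBundle 𝓘(ℝ, E) M)) x₀ := by
  have hmax := IsManifold.subset_maximalAtlas (I := 𝓘(ℝ, E)) (n := ∞) he
  -- A coordinate field is the tangent map of `e.symm` applied to the constant section `(x, v)`.
  have h1 := (contMDiffOn_symm_of_mem_maximalAtlas hmax).contMDiffOn_tangentMapWithin
    (m := ∞) (by simp) e.open_target.uniqueMDiffOn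
  have h2 : ContMDiffAt 𝓘(ℝ, E) (𝓘(ℝ, E).prod 𝓘(ℝ, E)) ∞
      (fun x : E => (⟨x, v⟩ : TangentBundle 𝓘(ℝ, E) E)) x₀ := by
    rw [Bundle.contMDiffAt_totalSpace]
    exact ⟨contMDiffAt_id, by simpa using contMDiffAt_const⟩
  have h3 := (h1 ⟨x₀, v⟩ hx₀).comp x₀ (t := Bundle.TotalSpace.proj ⁻¹' e.target)
    h2.contMDiffWithinAt (s := e.target) (fun x hx => hx)
  refine (h3.contMDiffAt (e.open_target.mem_nhds hx₀)).congr_of_eventuallyEq ?_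
  filter_upwards [e.open_target.mem_nhds hx₀] with x hx
  simp only [Function.comp_apply, tangentMapWithin]
  rw [mfderivWithin_of_isOpen e.open_target hx]

/-- Where the vector field has constant length, the horizontal derivatives of the Randers function
and of the Riemannian norm in the direction of the field are proportional. -/
theorem fderiv_randersFinsler_base (he : e ∈ atlas E M)
    (hX : ContMDiff 𝓘(ℝ, E) (𝓘(ℝ, E).prod 𝓘(ℝ, E)) ∞
      (fun x : M => (⟨x, X x⟩ : TangentBundle 𝓘(ℝ, E) M)))
    {k : ℝ} (hk : 0 < k) (hXk : ∀ x, a.inner x (X x) (X x) = k) {x₀ v : E} (hx₀ : x₀ ∈ e.target)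
    (hv : mfderiv 𝓘(ℝ, E) 𝓘(ℝ, E) e.symm x₀ v = X (e.symm x₀)) :
    fderiv ℝ (fun x => finslerInChart (randersFinsler a X) e x v) x₀ =
      (1 + √k) • fderiv ℝ (fun x => finslerInChart (riemannianFinsler a) e x v) x₀ := by
  have hmax := IsManifold.subset_maximalAtlas (I := 𝓘(ℝ, E)) (n := ∞) he
  have hf := contMDiffAt_symm_of_mem_maximalAtlas hmax hx₀
  have hV := contMDiffAt_mfderiv_symm_const he hx₀ v
  have hXe : ContMDiffAt 𝓘(ℝ, E) (𝓘(ℝ, E).prod 𝓘(ℝ, E)) ∞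
      (fun x => (⟨e.symm x, X (e.symm x)⟩ : TangentBundle 𝓘(ℝ, E) M)) x₀ :=
    (hX (e.symm x₀)).comp x₀ hf
  set A : E → ℝ := fun x => a.inner (e.symm x) (mfderiv 𝓘(ℝ, E) 𝓘(ℝ, E) e.symm x v)
    (mfderiv 𝓘(ℝ, E) 𝓘(ℝ, E) e.symm x v)
  set B : E → ℝ := fun x => a.inner (e.symm x) (X (e.symm x))
    (mfderiv 𝓘(ℝ, E) 𝓘(ℝ, E) e.symm x v)
  have hA : HasFDerivAt A (fderiv ℝ A x₀) x₀ := (differentiableAt_inner_along hf hV hV).hasFDerivAt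
  have hB : HasFDerivAt B (fderiv ℝ B x₀) x₀ := (differentiableAt_inner_along hf hXe hV).hasFDerivAt
  have hAx : A x₀ = k := by simp only [A]; rw [hv]; exact hXk _
  have hBx : B x₀ = k := by simp only [B]; rw [hv]; exact hXk _
  -- This is the squared length of `X - V`, which attains its minimum `0` at `x₀`.
  have hnonneg : ∀ x, 0 ≤ k - 2 * B x + A x := fun x => by
    rw [← hXk (e.symm x), ← riemannianMetric_sub_self]
    exact riemannianMetric_self_nonneg _ _
  have hmin : IsLocalMin (fun x => k - 2 * B x + A x) x₀ :=
    Filter.Eventually.of_forall fun x => by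
      have h := hnonneg x
      change k - 2 * B x₀ + A x₀ ≤ k - 2 * B x + A x
      rw [hAx, hBx]
      linarith
  have hzero := hmin.hasFDerivAt_eq_zero (((hB.const_mul 2).const_sub k).add hA)
  have hBA : fderiv ℝ B x₀ = (1 / 2 : ℝ) • fderiv ℝ A x₀ := by
    have h : fderiv ℝ A x₀ = (2 : ℝ) • fderiv ℝ B x₀ := by
      rw [neg_add_eq_zero] at hzero
      exact hzero.symm
    rw [h, smul_smul]
    norm_num
  have hα := hA.sqrt (by rw [hAx]; exact hk.ne')
  have hF := hα.add hB
  have e1 : fderiv ℝ (fun x => finslerInChart (riemannianFinsler a) e x v) x₀ = _ := hα.fderiv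
  have e2 : fderiv ℝ (fun x => finslerInChart (randersFinsler a X) e x v) x₀ = _ := hF.fderiv
  -- The factor comes from `1 / (2√k) + 1 / 2 = (1 + √k) / (2√k)`.
  rw [e1, e2, hBA, hAx, smul_smul, ← add_smul]
  congr 1
  have := Real.sqrt_pos.2 hk
  field_simp

/-- The vertical derivatives of the Randers function and of the Riemannian norm at the vector field
are proportional. -/
theorem fderiv_randersFinsler_fiber {k : ℝ} (hk : 0 < k) {x v : E}
    (hXk : a.inner (e.symm x) (X (e.symm x)) (X (e.symm x)) = k)
    (hv : mfderiv 𝓘(ℝ, E) 𝓘(ℝ, E) e.symm x v = X (e.symm x)) :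
    fderiv ℝ (fun y => finslerInChart (randersFinsler a X) e x y) v =
      (1 + √k) • fderiv ℝ (fun y => finslerInChart (riemannianFinsler a) e x y) v := by
  let D : E →L[ℝ] E := mfderiv 𝓘(ℝ, E) 𝓘(ℝ, E) e.symm x
  let g : E →L[ℝ] E →L[ℝ] ℝ := a.inner (e.symm x)
  have hsymm : ∀ u w, g u w = g w u := a.symm (e.symm x)
  let β : E →L[ℝ] ℝ := (g (X (e.symm x))).comp D
  have hDv : D v = X (e.symm x) := hv
  have hgv : g (D v) (D v) = k := by rw [hDv]; exact hXk
  have hA : HasFDerivAt (fun y => g (D y) (D y)) ((2 : ℝ) • β) v := by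
    have h := (g.comp D).hasFDerivAt (x := v) |>.clm_apply (D.hasFDerivAt (x := v))
    refine h.congr_fderiv ?_
    ext w
    simp only [β, add_apply, smul_apply,
      ContinuousLinearMap.comp_apply, ContinuousLinearMap.flip_apply, smul_eq_mul]
    rw [hsymm (D w) (D v), hDv]
    ring
  have hα := hA.sqrt (by rw [hgv]; exact hk.ne')
  have hF := hα.add (β.hasFDerivAt (x := v))
  have e1 : fderiv ℝ (fun y => finslerInChart (riemannianFinsler a) e x y) v = _ := hα.fderiv
  have e2 : fderiv ℝ (fun y => finslerInChart (randersFinsler a X) e x y) v = _ := hF.fderiv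
  rw [e1, e2, hgv]
  have := Real.sqrt_pos.2 hk
  ext w
  simp only [add_apply, smul_apply, smul_eq_mul]
  field_simp

/-- The equation is linear in the Lagrangian. The fibre relation is needed near `t` because it gets
differentiated in time, the base relation only at `t`. -/
theorem eulerLagrangeAt_iff_of_fderiv_eq_smul {L L' : E → E → ℝ} {c : ℝ → E} {t r : ℝ} (hr : r ≠ 0)
    (hfiber : ∀ᶠ s in 𝓝 t, fderiv ℝ (fun y => L' (c s) y) (deriv c s) =
      r • fderiv ℝ (fun y => L (c s) y) (deriv c s))
    (hbase : fderiv ℝ (fun x => L' x (deriv c t)) (c t) =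
      r • fderiv ℝ (fun x => L x (deriv c t)) (c t)) :
    EulerLagrangeAt L c t ↔ EulerLagrangeAt L' c t := by
  unfold EulerLagrangeAt
  rw [hbase, Filter.EventuallyEq.hasDerivAt_iff hfiber]
  refine ⟨fun h => h.const_smul r, fun h => ?_⟩
  simpa [Pi.smul_def, smul_smul, inv_mul_cancel₀ hr] using h.const_smul r⁻¹

/-- An integral curve of a vector field `X` of constant length is a constant speed geodesic of the
Riemannian metric if and only if it is one of the Randers metric defined by `X`. -/
theorem isConstantSpeedGeodesic_riemannian_iff_randers
    (hX : ContMDiff 𝓘(ℝ, E) (𝓘(ℝ, E).prod 𝓘(ℝ, E)) ∞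
      (fun x : M => (⟨x, X x⟩ : TangentBundle 𝓘(ℝ, E) M)))
    {k : ℝ} (hXk : ∀ x, a.inner x (X x) (X x) = k)
    {σ : ℝ → M} (hσ : ContMDiff 𝓘(ℝ, ℝ) 𝓘(ℝ, E) ∞ σ) (hvel : ∀ t, velocity σ t = X (σ t)) :
    IsConstantSpeedGeodesic (riemannianFinsler a) σ ↔
      IsConstantSpeedGeodesic (randersFinsler a X) σ := by
  have hα : ∀ t, riemannianFinsler a (σ t) (velocity σ t) = √k := fun t => by
    rw [hvel, riemannianFinsler, hXk]
  have hF : ∀ t, randersFinsler a X (σ t) (velocity σ t) = √k + k := fun t => by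
    rw [hvel, randersFinsler, hXk]
  -- Positivity of `k` keeps the velocity away from the zero section, where the norm is not smooth.
  have hEL : 0 < k → ∀ e ∈ atlas E M, ∀ t : ℝ, σ t ∈ e.source →
      (EulerLagrangeAt (finslerInChart (riemannianFinsler a) e) (fun s => e (σ s)) t ↔
        EulerLagrangeAt (finslerInChart (randersFinsler a X) e) (fun s => e (σ s)) t) := by
    intro hk e he t ht
    have hv : ∀ s, σ s ∈ e.source → mfderiv 𝓘(ℝ, E) 𝓘(ℝ, E) e.symm (e (σ s))
        (deriv (fun s => e (σ s)) s) = X (e.symm (e (σ s))) := fun s hs => by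
      have h1 : (X (e.symm (e (σ s))) : E) = (X (σ s) : E) := by rw [e.left_inv hs]
      exact (mfderiv_symm_deriv_chart he hσ hs).trans ((hvel s).trans h1.symm)
    refine eulerLagrangeAt_iff_of_fderiv_eq_smul (r := 1 + √k) (by positivity) ?_ ?_
    · filter_upwards [hσ.continuous.continuousAt.preimage_mem_nhds (e.open_source.mem_nhds ht)]
        with s hs
      exact fderiv_randersFinsler_fiber hk (hXk _) (hv s hs)
    · exact fderiv_randersFinsler_base he hX hk hXk (e.map_source ht) (hv t ht)
  constructor
  · rintro ⟨_, ⟨c, hc, hcσ⟩, h⟩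
    have hk : 0 < k := Real.sqrt_pos.1 (by rw [← hα 0, hcσ 0]; exact hc)
    exact ⟨hσ, ⟨√k + k, by positivity, hF⟩, fun e he t ht => (hEL hk e he t ht).1 (h e he t ht)⟩
  · rintro ⟨_, ⟨c, hc, hcσ⟩, h⟩
    -- If `k ≤ 0` then `√k = 0`, and the speed `√k + k` would not be positive.
    have hk : 0 < k := by
      by_contra hk
      rw [← hcσ 0, hF 0, Real.sqrt_eq_zero_of_nonpos (not_lt.1 hk)] at hc
      linarith
    exact ⟨hσ, ⟨√k, by positivity, hα⟩, fun e he t ht => (hEL hk e he t ht).2 (h e he t ht)⟩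

end Coordinates

theorem theorem4p1
    {EG : Type*} [NormedAddCommGroup EG] [NormedSpace ℝ EG] [FiniteDimensional ℝ EG]
    {G : Type*} [Group G] [TopologicalSpace G] [ChartedSpace EG G] [LieGroup 𝓘(ℝ, EG) ∞ G]
    {E : Type*} [NormedAddCommGroup E] [NormedSpace ℝ E] [FiniteDimensional ℝ E]
    {M : Type*} [TopologicalSpace M] [ChartedSpace E M] [IsManifold 𝓘(ℝ, E) ∞ M]
    [MulAction G M] (hGM : IsHomogeneousSpace EG G E M) (p : M)
    (a : Bundle.ContMDiffRiemannianMetric 𝓘(ℝ, E) ∞ E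
      (fun x : M => TangentSpace 𝓘(ℝ, E) x))
    (X : (x : M) → TangentSpace 𝓘(ℝ, E) x)
    (hX : ContMDiff 𝓘(ℝ, E) (𝓘(ℝ, E).prod 𝓘(ℝ, E)) ∞
      (fun x : M => (⟨x, X x⟩ : TangentBundle 𝓘(ℝ, E) M)))
    (hX_lt : ∀ x : M, a.inner x (X x) (X x) < 1)
    (hF : IsInvariantFinsler G (randersFinsler a X))
    (W : GroupLieAlgebra 𝓘(ℝ, EG) G) (hW : fundamentalVector W p = X p) :
    IsGeodesicVector (riemannianFinsler a) p W ↔ IsGeodesicVector (randersFinsler a X) p W := by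

  have := hGM.smooth_action
  have := hGM.transitive
  -- The same one-parameter subgroup serves both metrics.
  refine and_congr_right fun _ => exists_congr fun φ => and_congr_right fun hφ => ?_
  refine isConstantSpeedGeodesic_riemannian_iff_randers hX (fun x => hF.inner_self_eq p x)
    (hφ.contMDiff_orbit p) fun t => ?_
  rw [hφ.velocity_orbit p t, hW]
  exact hF.mfderiv_smul_apply (φ t) p
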